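/- All rings are commutative and Noetherian with identity. A finitely generated module $M$ over a ring $R$ has constant rank if there is an integer $n\ge 0$ such that $M_{\mathfrak p}\cong R_{\mathfrak p}^{n}$ for every associated prime $\mathfrak p$ of $R$. A ring $R$ satisfies (SAC) if every finitely generated $R$-module $M$ with $\operatorname{Ext}^i_R(M,R)=0$ for all $i>0$ and $\operatorname{Ext}^i_R(M,M)=0$ for all sufficiently large $i$ has $\operatorname{Ext}^i_R(M,M)=0$ for all $i>0$. A ring $R$ satisfies (SACC) if this implication holds for every finitely generated $R$-module $M$ with constant rank. Theorem 2.3. Let $(R,\mathfrak m)$ be a Noetherian local ring and let $x\in\mathfrak m$ be a non-zerodivisor on $R$ (so that $R$ has positive depth). If $R$ satisfies (SACC), then $R/xR$ satisfies (SAC). -/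

import Mathlib

universe u

open CategoryTheory

/-- `Ext^i_R(M, N) = 0`. -/
def ExtVanishes (R : Type u) [CommRing R] (M N : Type u) [AddCommGroup M] [Module R M]
    [AddCommGroup N] [Module R N] (i : ℕ) : Prop :=
  Subsingleton (Abelian.Ext (ModuleCat.of R M) (ModuleCat.of R N) i)

/-- If `Ext^{>0}_R(M, R) = 0` and `Ext^{≫0}_R(M, M) = 0`, then `Ext^{>0}_R(M, M) = 0`. -/
def SymmetricAuslanderFor (R : Type u) [CommRing R] (M : Type u) [AddCommGroup M]
    [Module R M] : Prop :=
  (∀ i : ℕ, 0 < i → ExtVanishes R M R i) →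
  (∃ n : ℕ, ∀ i : ℕ, n < i → ExtVanishes R M M i) →
  ∀ i : ℕ, 0 < i → ExtVanishes R M M i

/-- The symmetric Auslander condition (SAC). -/
def SAC (R : Type u) [CommRing R] : Prop :=
  ∀ (M : Type u) [AddCommGroup M] [Module R M] [Module.Finite R M],
    SymmetricAuslanderFor R M

/-- `M` has constant rank: there is one `n` such that `M_p` is free of rank `n` over `R_p`
for every associated prime `p` of `R`. -/
def HasConstantRank (R : Type u) [CommRing R] (M : Type u) [AddCommGroup M]
    [Module R M] : Prop :=
  ∃ n : ℕ, ∀ (p : Ideal R) [p.IsPrime], p ∈ associatedPrimes R R →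
    Nonempty (LocalizedModule p.primeCompl M ≃ₗ[Localization.AtPrime p]
      (Fin n → Localization.AtPrime p))

/-- The symmetric Auslander condition for modules with constant rank (SACC). -/
def SACC (R : Type u) [CommRing R] : Prop :=
  ∀ (M : Type u) [AddCommGroup M] [Module R M] [Module.Finite R M],
    HasConstantRank R M → SymmetricAuslanderFor R M

/-! Write `S = R/xR`, let `M` be an `S`-module as in (SAC), and let `N` be its first syzygy over
`R`. As `x` kills `M` and is regular, `N` has constant rank (`hasConstantRank_ker`), so (SACC)
applies to `N` once its hypotheses are verified. Two facts link the rings. First, `Ext_R^i(N, L) =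
Ext_S^i(N/xN, L)` for `i > 0` and `S`-modules `L`; only the vanishing is needed
(`extVanishes_iff_of_regular`). Second, `0 → M → N/xN → ΩM → 0` is exact, with `ΩM` the syzygy over
`S` (`exists_exact_of_syzygy`). They carry the hypotheses on `M` to `N`, and turn the conclusion for
`N` into `Ext_S^{>0}(N/xN, M) = 0`. The sequence then embeds `Ext_S^i(M, M)` in `Ext_S^{i+1}(ΩM, M)
= Ext_S^{i+2}(M, M)`, so vanishing in high degrees descends to all positive ones. -/

namespace ExtVanishes

open Abelian

/-! ### Vanishing of Ext along short exact sequences -/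

section LongExactSequence

variable {R : Type u} [CommRing R] {A B C : Type u} [AddCommGroup A] [Module R A]
  [AddCommGroup B] [Module R B] [AddCommGroup C] [Module R C]
  {f : A →ₗ[R] B} {g : B →ₗ[R] C}

lemma shortExact (hf : Function.Injective f) (hfg : Function.Exact f g)
    (hg : Function.Surjective g) :
    (ModuleCat.shortComplexOfCompEqZero f g hfg.linearMap_comp_eq_zero).ShortExact :=
  ModuleCat.shortComplex_shortExact _ hfg hf hg

variable {L : Type u} [AddCommGroup L] [Module R L] {i : ℕ}

lemma contravariant_middle (hf : Function.Injective f) (hfg : Function.Exact f g)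
    (hg : Function.Surjective g) (hA : ExtVanishes R A L i) (hC : ExtVanishes R C L i) :
    ExtVanishes R B L i := by
  unfold ExtVanishes at *
  refine subsingleton_of_forall_eq 0 fun e ↦ ?_
  obtain ⟨e', rfl⟩ := Ext.contravariant_sequence_exact₂ (shortExact hf hfg hg) _ e
    (Subsingleton.elim (α := Ext (ModuleCat.of R A) (ModuleCat.of R L) i) _ _)
  rw [Subsingleton.elim (α := Ext (ModuleCat.of R C) (ModuleCat.of R L) i) e' 0, Ext.comp_zero]

lemma contravariant_left (hf : Function.Injective f) (hfg : Function.Exact f g)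
    (hg : Function.Surjective g) (hB : ExtVanishes R B L i) (hC : ExtVanishes R C L (i + 1)) :
    ExtVanishes R A L i := by
  unfold ExtVanishes at *
  refine subsingleton_of_forall_eq 0 fun e ↦ ?_
  obtain ⟨e', rfl⟩ := Ext.contravariant_sequence_exact₁ (shortExact hf hfg hg) _ e (add_comm 1 i)
    (Subsingleton.elim (α := Ext (ModuleCat.of R C) (ModuleCat.of R L) (i + 1)) _ _)
  rw [Subsingleton.elim (α := Ext (ModuleCat.of R B) (ModuleCat.of R L) i) e' 0, Ext.comp_zero]

lemma contravariant_right (hf : Function.Injective f) (hfg : Function.Exact f g)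
    (hg : Function.Surjective g) (hA : ExtVanishes R A L i) (hB : ExtVanishes R B L (i + 1)) :
    ExtVanishes R C L (i + 1) := by
  unfold ExtVanishes at *
  refine subsingleton_of_forall_eq 0 fun e ↦ ?_
  obtain ⟨e', rfl⟩ := Ext.contravariant_sequence_exact₃ (shortExact hf hfg hg) _ e
    (Subsingleton.elim (α := Ext (ModuleCat.of R B) (ModuleCat.of R L) (i + 1)) _ _) (add_comm 1 i)
  rw [Subsingleton.elim (α := Ext (ModuleCat.of R A) (ModuleCat.of R L) i) e' 0, Ext.comp_zero]

lemma covariant_left (hf : Function.Injective f) (hfg : Function.Exact f g)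
    (hg : Function.Surjective g) (hC : ExtVanishes R L C i) (hB : ExtVanishes R L B (i + 1)) :
    ExtVanishes R L A (i + 1) := by
  unfold ExtVanishes at *
  refine subsingleton_of_forall_eq 0 fun e ↦ ?_
  obtain ⟨e', rfl⟩ := Ext.covariant_sequence_exact₁ _ (shortExact hf hfg hg) e
    (Subsingleton.elim (α := Ext (ModuleCat.of R L) (ModuleCat.of R B) (i + 1)) _ _) rfl
  rw [Subsingleton.elim (α := Ext (ModuleCat.of R L) (ModuleCat.of R C) i) e' 0, Ext.zero_comp]

lemma covariant_right (hf : Function.Injective f) (hfg : Function.Exact f g)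
    (hg : Function.Surjective g) (hB : ExtVanishes R L B i) (hA : ExtVanishes R L A (i + 1)) :
    ExtVanishes R L C i := by
  unfold ExtVanishes at *
  refine subsingleton_of_forall_eq 0 fun e ↦ ?_
  obtain ⟨e', rfl⟩ := Ext.covariant_sequence_exact₃ _ (shortExact hf hfg hg) e rfl
    (Subsingleton.elim (α := Ext (ModuleCat.of R L) (ModuleCat.of R A) (i + 1)) _ _)
  rw [Subsingleton.elim (α := Ext (ModuleCat.of R L) (ModuleCat.of R B) i) e' 0, Ext.zero_comp]

end LongExactSequence

/-! ### Dimension shifting and the action of `x` on Ext -/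

section Basic

variable {R : Type u} [CommRing R]

lemma of_projective (P L : Type u) [AddCommGroup P] [Module R P] [Module.Projective R P]
    [AddCommGroup L] [Module R L] (i : ℕ) : ExtVanishes R P L (i + 1) :=
  have : Projective (ModuleCat.of R P) := ModuleCat.projective_of_categoryTheory_projective _
  Ext.subsingleton_of_projective _ _ _

variable {A B C : Type u} [AddCommGroup A] [Module R A]
  [AddCommGroup B] [Module R B] [AddCommGroup C] [Module R C]
  {f : A →ₗ[R] B} {g : B →ₗ[R] C} {L : Type u} [AddCommGroup L] [Module R L]

/-- With `B` projective, `Ext¹(C, L) = 0` iff every map `A → L` extends to `B`. -/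
lemma one_iff_forall_exists_extension [Module.Projective R B] (hf : Function.Injective f)
    (hfg : Function.Exact f g) (hg : Function.Surjective g) :
    ExtVanishes R C L 1 ↔ ∀ φ : A →ₗ[R] L, ∃ ψ : B →ₗ[R] L, ψ ∘ₗ f = φ := by
  have hS := shortExact hf hfg hg
  constructor
  · intro h φ
    obtain ⟨e, he⟩ := Ext.contravariant_sequence_exact₁ hS (ModuleCat.of R L)
      (Ext.mk₀ (ModuleCat.ofHom φ)) (add_zero 1)
      (@Subsingleton.elim (Ext (ModuleCat.of R C) (ModuleCat.of R L) 1) h _ _)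
    obtain ⟨ψ, rfl⟩ := (Ext.mk₀_bijective _ _).2 e
    rw [Ext.mk₀_comp_mk₀] at he
    exact ⟨ψ.hom, congrArg ModuleCat.Hom.hom ((Ext.mk₀_bijective _ _).1 he)⟩
  · intro h
    refine subsingleton_of_forall_eq 0 fun e ↦ ?_
    obtain ⟨e', rfl⟩ := Ext.contravariant_sequence_exact₃ hS (ModuleCat.of R L) e
      (@Subsingleton.elim _ (of_projective (R := R) B L 0) _ _) (add_zero 1)
    obtain ⟨φ, rfl⟩ := (Ext.mk₀_bijective _ _).2 e'
    obtain ⟨ψ, hψ⟩ := h φ.hom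
    have : φ = ModuleCat.ofHom f ≫ ModuleCat.ofHom ψ := by
      ext a
      exact (LinearMap.congr_fun hψ a).symm
    rw [this, ← Ext.mk₀_comp_mk₀]
    exact hS.extClass_comp_assoc _

/-- Dimension shifting. -/
lemma add_two_iff [Module.Projective R B] (hf : Function.Injective f)
    (hfg : Function.Exact f g) (hg : Function.Surjective g) (i : ℕ) :
    ExtVanishes R C L (i + 2) ↔ ExtVanishes R A L (i + 1) :=
  ⟨contravariant_left hf hfg hg (of_projective B L i),
    fun h ↦ contravariant_right hf hfg hg h (of_projective B L (i + 1))⟩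

lemma pi {ι : Type} [Fintype ι] {X : Type u} [AddCommGroup X] [Module R X] {i : ℕ}
    (h : ExtVanishes R X L i) : ExtVanishes R X (ι → L) i := by
  classical
  refine subsingleton_of_forall_eq 0 fun e ↦ ?_
  have hid : 𝟙 (ModuleCat.of R (ι → L)) = ∑ j : ι,
      ModuleCat.ofHom (LinearMap.proj j : (ι → L) →ₗ[R] L) ≫
        ModuleCat.ofHom (LinearMap.single R (fun _ : ι ↦ L) j) := by
    ext v k
    simp [ModuleCat.hom_sum, Finset.sum_apply, Pi.single_apply]
  rw [← Ext.comp_mk₀_id e, hid, Ext.mk₀_sum, Ext.comp_sum]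
  refine Finset.sum_eq_zero fun j _ ↦ ?_
  rw [← Ext.mk₀_comp_mk₀, ← Ext.comp_assoc_of_second_deg_zero,
    @Subsingleton.elim _ h (e.comp (Ext.mk₀ (ModuleCat.ofHom (LinearMap.proj j))) _) 0,
    Ext.zero_comp]

/-- If `x` kills `X` and is injective on `L`, then `Ext(X, L)` vanishes as soon as
`Ext(X, L / xL)` does. -/
lemma of_quotient_of_smul_eq_zero {X : Type u} [AddCommGroup X] [Module R X] (x : R)
    (hX : ∀ m : X, x • m = 0) {q : L →ₗ[R] C}
    (hf : Function.Injective (x • LinearMap.id : L →ₗ[R] L))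
    (hfg : Function.Exact (x • LinearMap.id : L →ₗ[R] L) q) (hg : Function.Surjective q) {i : ℕ}
    (h : ExtVanishes R X C i) : ExtVanishes R X L i := by
  refine subsingleton_of_forall_eq 0 fun e ↦ ?_
  obtain ⟨e', rfl⟩ := Ext.covariant_sequence_exact₂ _ (shortExact hf hfg hg) e
    (@Subsingleton.elim _ h _ _)
  -- The class is now `x • e'`, and the scalar can be moved from `L` to `X`, where it acts as zero.
  have h₁ : ModuleCat.ofHom (x • LinearMap.id : L →ₗ[R] L) = x • 𝟙 (ModuleCat.of R L) := rfl
  have h₂ : x • 𝟙 (ModuleCat.of R X) = 0 := by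
    ext m
    exact hX m
  change e'.comp (Ext.mk₀ (ModuleCat.ofHom (x • LinearMap.id))) _ = 0
  rw [h₁, Ext.mk₀_smul, Ext.comp_smul, Ext.comp_mk₀_id, ← Ext.mk₀_id_comp e', ← Ext.smul_comp,
    ← Ext.mk₀_smul, h₂, Ext.mk₀_zero, Ext.zero_comp]

end Basic

end ExtVanishes

/-! ### Change of rings from `R` to `R/xR` -/

section ChangeOfRings

variable {R S : Type u} [CommRing R] [CommRing S] [Algebra R S]

/-- A map that vanishes on the kernel of a surjection `q` factors through `q`, linearly over the
quotient ring `S` if the modules are defined over it. -/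
lemma exists_comp_eq_of_ker_le (hS : Function.Surjective (algebraMap R S))
    {N Q L : Type*} [AddCommGroup N] [Module R N]
    [AddCommGroup Q] [Module R Q] [Module S Q] [IsScalarTower R S Q]
    [AddCommGroup L] [Module R L] [Module S L] [IsScalarTower R S L]
    {q : N →ₗ[R] Q} (hq : Function.Surjective q) (φ : N →ₗ[R] L)
    (h : ∀ n, q n = 0 → φ n = 0) : ∃ ψ : Q →ₗ[S] L, ∀ n, ψ (q n) = φ n := by
  refine ⟨((((LinearMap.ker q).liftQ φ h).comp
    (q.quotKerEquivOfSurjective hq).symm.toLinearMap).extendScalarsOfSurjective hS), fun n ↦ ?_⟩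
  have : (q.quotKerEquivOfSurjective hq).symm (q n) = (LinearMap.ker q).mkQ n :=
    (LinearEquiv.symm_apply_eq _).2 rfl
  change (LinearMap.ker q).liftQ φ h ((q.quotKerEquivOfSurjective hq).symm (q n)) = φ n
  rw [this]
  rfl

/-- If `S = R / xR`, the element `x` is regular on `R` and on `N`, and `Q = N / xN`, then
`Ext_R(N, L)` and `Ext_S(Q, L)` vanish in the same positive degrees, for any `S`-module `L`. -/
lemma extVanishes_iff_of_regular {x : R} (hS : Function.Surjective (algebraMap R S))
    (hker : ∀ r : R, algebraMap R S r = 0 ↔ ∃ s, x • s = r) (hx : ∀ r : R, x • r = 0 → r = 0)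
    {L : Type u} [AddCommGroup L] [Module R L] [Module S L] [IsScalarTower R S L] (i : ℕ)
    {N Q : Type u} [AddCommGroup N] [Module R N]
    [AddCommGroup Q] [Module R Q] [Module S Q] [IsScalarTower R S Q]
    {q : N →ₗ[R] Q} (hq : Function.Surjective q) (hqx : ∀ n, q n = 0 ↔ ∃ m, x • m = n)
    (hN : ∀ n : N, x • n = 0 → n = 0) :
    ExtVanishes R N L (i + 1) ↔ ExtVanishes S Q L (i + 1) := by
  have hxL (l : L) : x • l = 0 := by
    rw [← algebraMap_smul S x l, (hker x).2 ⟨1, mul_one x⟩, zero_smul]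
  induction i using Nat.strong_induction_on generalizing N Q with | h i ih =>
  -- Compatible free covers of `N` and `Q`, indexed by the elements of `N`. Since `x` is regular on
  -- `N`, `ker G` is again `ker F` modulo `x`, so dimension shifting reproduces the hypotheses.
  let F : (N →₀ R) →ₗ[R] N := Finsupp.linearCombination R id
  let G : (N →₀ S) →ₗ[S] Q := Finsupp.linearCombination S q
  let p : (N →₀ R) →ₗ[R] (N →₀ S) := Finsupp.mapRange.linearMap (Algebra.linearMap R S)
  have hF : Function.Surjective F := Finsupp.linearCombination_id_surjective R N
  have hp : Function.Surjective p := Finsupp.mapRange_surjective _ (map_zero _) hS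
  have hsq (v : N →₀ R) : G (p v) = q (F v) := by
    have : G.restrictScalars R ∘ₗ p = q ∘ₗ F := by
      ext n
      simp [G, p, F]
    exact LinearMap.congr_fun this v
  have hG : Function.Surjective G := fun y ↦ by
    obtain ⟨n, rfl⟩ := hq y
    obtain ⟨v, rfl⟩ := hF n
    exact ⟨p v, hsq v⟩
  have hpx (v : N →₀ R) : p v = 0 ↔ ∃ w, x • w = v := by
    constructor
    · intro h
      have h' (n : N) : algebraMap R S (v n) = 0 := DFunLike.congr_fun h n
      choose s hs using fun n ↦ (hker (v n)).1 (h' n)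
      refine ⟨Finsupp.onFinset v.support s fun n hn ↦ ?_, Finsupp.ext hs⟩
      rw [Finsupp.mem_support_iff]
      exact fun h0 ↦ hn (hx _ ((hs n).trans h0))
    · rintro ⟨w, rfl⟩
      ext n
      change algebraMap R S (x • w n) = 0
      exact (hker _).2 ⟨_, rfl⟩
  have hxF (v : N →₀ R) (h : x • v = 0) : v = 0 :=
    Finsupp.ext fun n ↦ hx _ (DFunLike.congr_fun h n)
  let k : LinearMap.ker F →ₗ[R] LinearMap.ker G :=
    { toFun v := ⟨p v, by rw [LinearMap.mem_ker, hsq, v.2, map_zero]⟩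
      map_add' v w := Subtype.ext (map_add p v.1 w.1)
      map_smul' r v := Subtype.ext (map_smul p r v.1) }
  have hk : Function.Surjective k := by
    rintro ⟨u, hu⟩
    obtain ⟨w, rfl⟩ := hp u
    rw [LinearMap.mem_ker, hsq, hqx] at hu
    obtain ⟨m, hm⟩ := hu
    obtain ⟨w', rfl⟩ := hF m
    refine ⟨⟨w - x • w', by rw [LinearMap.mem_ker, map_sub, map_smul, hm, sub_self]⟩,
      Subtype.ext ?_⟩
    change p (w - x • w') = p w
    rw [map_sub, (hpx _).2 ⟨w', rfl⟩, sub_zero]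
  have hkx (v : LinearMap.ker F) : k v = 0 ↔ ∃ w, x • w = v := by
    constructor
    · intro h
      obtain ⟨w, hw⟩ := (hpx v).1 (congrArg Subtype.val h)
      refine ⟨⟨w, hN _ ?_⟩, Subtype.ext hw⟩
      rw [← map_smul, hw, v.2]
    · rintro ⟨w, rfl⟩
      exact Subtype.ext ((hpx _).2 ⟨w, rfl⟩)
  have hiF : Function.Injective (LinearMap.ker F).subtype := Subtype.val_injective
  have hiG : Function.Injective (LinearMap.ker G).subtype := Subtype.val_injective
  have hexF : Function.Exact (LinearMap.ker F).subtype F := LinearMap.exact_subtype_ker_map F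
  have hexG : Function.Exact (LinearMap.ker G).subtype G := LinearMap.exact_subtype_ker_map G
  rcases i with _ | i
  -- In degree one, compare extension problems: `x` kills `L`, so maps into `L` factor through
  -- reduction modulo `x`.
  · rw [zero_add, ExtVanishes.one_iff_forall_exists_extension (A := LinearMap.ker F) hiF hexF hF,
      ExtVanishes.one_iff_forall_exists_extension (A := LinearMap.ker G) hiG hexG hG]
    constructor
    · intro h φ
      obtain ⟨ψ, hψ⟩ := h (φ.restrictScalars R ∘ₗ k)
      obtain ⟨χ, hχ⟩ := exists_comp_eq_of_ker_le hS hp ψ fun v hv ↦ by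
        obtain ⟨w, rfl⟩ := (hpx v).1 hv
        rw [map_smul, hxL]
      refine ⟨χ, LinearMap.ext fun u ↦ ?_⟩
      obtain ⟨v, rfl⟩ := hk u
      exact (hχ v).trans (LinearMap.congr_fun hψ v)
    · intro h φ
      obtain ⟨ψ, hψ⟩ := exists_comp_eq_of_ker_le (N := LinearMap.ker F)
        (Q := LinearMap.ker G) hS hk φ fun v hv ↦ by
        obtain ⟨w, rfl⟩ := (hkx v).1 hv
        rw [map_smul, hxL]
      obtain ⟨χ, hχ⟩ := h ψ
      refine ⟨χ.restrictScalars R ∘ₗ p, LinearMap.ext fun v ↦ ?_⟩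
      exact (LinearMap.congr_fun hχ (k v)).trans (hψ v)
  · rw [ExtVanishes.add_two_iff (A := LinearMap.ker F) hiF hexF hF,
      ExtVanishes.add_two_iff (A := LinearMap.ker G) hiG hexG hG]
    exact ih i i.lt_succ_self hk hkx fun v hv ↦ Subtype.ext (hxF v (congrArg Subtype.val hv))

end ChangeOfRings

/-! ### Syzygies over `R` of modules killed by `x` -/

/-- A first syzygy of a module killed by a nonzerodivisor has constant rank. -/
lemma hasConstantRank_ker {R : Type u} [CommRing R] [IsNoetherianRing R] {x : R}
    (hx : x ∈ nonZeroDivisors R) {M : Type u} [AddCommGroup M] [Module R M]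
    (hM : ∀ m : M, x • m = 0) {n : ℕ} (f : (Fin n → R) →ₗ[R] M) :
    HasConstantRank R (LinearMap.ker f) := by
  refine ⟨n, fun p _ hp ↦ ?_⟩
  have hxp : x ∈ p.primeCompl := fun h ↦ by
    have : x ∈ ⋃ p ∈ associatedPrimes R R, (p : Set R) := Set.mem_biUnion hp h
    rw [biUnion_associatedPrimes_eq_compl_nonZeroDivisors] at this
    exact this hx
  let g : (Fin n → R) →ₗ[R] (Fin n → Localization.AtPrime p) :=
    .pi fun i ↦ Algebra.linearMap R (Localization.AtPrime p) ∘ₗ .proj i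
  have hg : IsLocalizedModule p.primeCompl g := inferInstance
  -- `ker f` contains `xRⁿ` and `x` is invertible at `p`, so `ker f` and `Rⁿ` have the same
  -- localization.
  have : IsLocalizedModule p.primeCompl (g ∘ₗ (LinearMap.ker f).subtype) :=
    { map_units := hg.map_units
      surj y := by
        obtain ⟨⟨r, s⟩, hrs⟩ := hg.surj y
        refine ⟨⟨⟨x • r, by rw [LinearMap.mem_ker, map_smul, hM]⟩, ⟨x, hxp⟩ * s⟩, ?_⟩
        change _ = g (x • r)
        exact ((mul_smul x s.1 y).trans (congrArg (x • ·) hrs)).trans (map_smul g x r).symm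
      exists_of_eq h := by
        obtain ⟨c, hc⟩ := hg.exists_of_eq h
        exact ⟨c, Subtype.ext hc⟩ }
  exact ⟨(IsLocalizedModule.iso p.primeCompl
    (g ∘ₗ (LinearMap.ker f).subtype)).extendScalarsOfIsLocalization p.primeCompl _⟩

open scoped TensorProduct

/-- Reduction modulo `x` of a syzygy `N = ker f` over `R` of a module over `S = R / xR`: it is an
extension of the syzygy `ker g` over `S` by the module itself. -/
lemma exists_exact_of_syzygy {R S : Type u} [CommRing R] [CommRing S] [Algebra R S] {x : R}
    (hS : Function.Surjective (algebraMap R S))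
    {M F G Q : Type u} [AddCommGroup M] [Module R M] [Module S M] [IsScalarTower R S M]
    [AddCommGroup F] [Module R F] [AddCommGroup G] [Module R G] [Module S G] [IsScalarTower R S G]
    [AddCommGroup Q] [Module R Q] [Module S Q] [IsScalarTower R S Q]
    (hM : ∀ m : M, x • m = 0)
    {f : F →ₗ[R] M} (hf : Function.Surjective f) {g : G →ₗ[S] M}
    {p : F →ₗ[R] G} (hp : Function.Surjective p) (hpx : ∀ v, p v = 0 ↔ ∃ w, x • w = v)
    (hF : ∀ v : F, x • v = 0 → v = 0) (hgp : ∀ v, g (p v) = f v)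
    {q : LinearMap.ker f →ₗ[R] Q} (hq : Function.Surjective q)
    (hqx : ∀ n, q n = 0 ↔ ∃ m, x • m = n) :
    ∃ (a : M →ₗ[S] Q) (b : Q →ₗ[S] LinearMap.ker g),
      Function.Injective a ∧ Function.Exact a b ∧ Function.Surjective b := by
  -- The embedding of `M` sends `f v` to the class of `x • v`; it realizes `Tor₁^R(M, S) ≅ M`.
  let μ : F →ₗ[R] LinearMap.ker f :=
    (x • LinearMap.id : F →ₗ[R] F).codRestrict _ fun v ↦ by
      rw [LinearMap.mem_ker, LinearMap.smul_apply, map_smul, hM]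
  have hμ (v : F) : (μ v : F) = x • v := rfl
  let k : LinearMap.ker f →ₗ[R] LinearMap.ker g :=
    { toFun v := ⟨p v, by rw [LinearMap.mem_ker, hgp, v.2]⟩
      map_add' v w := Subtype.ext (map_add p v.1 w.1)
      map_smul' r v := Subtype.ext (map_smul p r v.1) }
  have hk (v : LinearMap.ker f) : (k v : G) = p v := rfl
  obtain ⟨a, ha⟩ := exists_comp_eq_of_ker_le hS hf (q ∘ₗ μ) fun v hv ↦
    (hqx _).2 ⟨⟨v, hv⟩, rfl⟩
  obtain ⟨b, hb⟩ := exists_comp_eq_of_ker_le hS hq k fun v hv ↦ by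
    obtain ⟨w, rfl⟩ := (hqx v).1 hv
    exact Subtype.ext ((hpx _).2 ⟨w, rfl⟩)
  refine ⟨a, b, (injective_iff_map_eq_zero a).2 fun m hm ↦ ?_, fun y ↦ ⟨fun hy ↦ ?_, ?_⟩,
    fun y ↦ ?_⟩
  · obtain ⟨v, rfl⟩ := hf m
    rw [ha] at hm
    obtain ⟨w, hw⟩ := (hqx _).1 hm
    have : (w : F) = v := sub_eq_zero.1 <| hF _ <| by
      rw [smul_sub, sub_eq_zero]
      exact congrArg Subtype.val hw
    rw [← this, w.2]
  · obtain ⟨v, rfl⟩ := hq y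
    rw [hb] at hy
    obtain ⟨w, hw⟩ := (hpx _).1 (congrArg Subtype.val hy)
    exact ⟨f w, (ha w).trans (congrArg q (Subtype.ext hw))⟩
  · rintro ⟨m, rfl⟩
    obtain ⟨v, rfl⟩ := hf m
    rw [ha]
    refine (hb _).trans (Subtype.ext ((hpx _).2 ⟨v, rfl⟩))
  · obtain ⟨v, hv⟩ := hp y
    exact ⟨q ⟨v, by rw [LinearMap.mem_ker, ← hgp, hv, y.2]⟩, (hb _).trans (Subtype.ext hv)⟩

/-! ### Descent of the condition from `N` to `M` -/

/-- If `S = R / xR` with `x` regular on `R`, the symmetric Auslander condition descends from a first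
syzygy over `R` of an `S`-module `M` to `M` itself. -/
lemma SymmetricAuslanderFor.of_ker {R S : Type u} [CommRing R] [CommRing S]
    [Algebra R S] {x : R} (hS : Function.Surjective (algebraMap R S))
    (hker : ∀ r : R, algebraMap R S r = 0 ↔ ∃ s, x • s = r) (hx : ∀ r : R, x • r = 0 → r = 0)
    {M : Type u} [AddCommGroup M] [Module R M] [Module S M] [IsScalarTower R S M]
    {n : ℕ} {f : (Fin n → R) →ₗ[R] M} (hf : Function.Surjective f)
    (hN : SymmetricAuslanderFor R (LinearMap.ker f)) :
    SymmetricAuslanderFor S M := by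
  rintro hMS ⟨d, hd⟩
  have hM (m : M) : x • m = 0 := by
    rw [← algebraMap_smul S x m, (hker x).2 ⟨1, mul_one x⟩, zero_smul]
  have hxF (v : Fin n → R) (h : x • v = 0) : v = 0 := funext fun i ↦ hx _ (congrFun h i)
  have hxN (v : LinearMap.ker f) (h : x • v = 0) : v = 0 :=
    Subtype.ext (hxF _ (congrArg Subtype.val h))
  let p : (Fin n → R) →ₗ[R] (Fin n → S) := (Algebra.linearMap R S).compLeft (Fin n)
  have hp : Function.Surjective p := hS.comp_left
  have hpx (v : Fin n → R) : p v = 0 ↔ ∃ w, x • w = v := by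
    constructor
    · intro h
      choose w hw using fun i ↦ (hker (v i)).1 (congrFun h i)
      exact ⟨w, funext hw⟩
    · rintro ⟨w, rfl⟩
      exact funext fun i ↦ (hker _).2 ⟨w i, rfl⟩
  obtain ⟨g, hgp⟩ := exists_comp_eq_of_ker_le hS hp f fun v hv ↦ by
    obtain ⟨w, rfl⟩ := (hpx v).1 hv
    rw [map_smul, hM]
  have hg : Function.Surjective g := fun m ↦ by
    obtain ⟨v, rfl⟩ := hf m
    exact ⟨p v, hgp v⟩
  let Q := TensorProduct R S (LinearMap.ker f)
  let q : LinearMap.ker f →ₗ[R] Q := TensorProduct.mk R S _ 1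
  have hq : Function.Surjective q := TensorProduct.mk_surjective R _ S hS
  have hqx (v : LinearMap.ker f) : q v = 0 ↔ ∃ w, x • w = v := by
    constructor
    · intro h
      have hex : Function.Exact (LinearMap.lsmul R R x) (Algebra.linearMap R S) := hker
      obtain ⟨t, ht⟩ := (rTensor_exact (LinearMap.ker f) hex hS (1 ⊗ₜ[R] v)).1 (by
        rw [LinearMap.rTensor_tmul, Algebra.linearMap_apply, map_one]
        exact h)
      refine ⟨TensorProduct.lid R _ t, ?_⟩
      have hlid : (TensorProduct.lid R (LinearMap.ker f)).toLinearMap ∘ₗ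
          (LinearMap.lsmul R R x).rTensor (LinearMap.ker f) =
          x • (TensorProduct.lid R (LinearMap.ker f)).toLinearMap := by
        ext
        simp
      exact (LinearMap.congr_fun hlid t).symm.trans (by simp [ht])
    · rintro ⟨w, rfl⟩
      rw [map_smul, ← algebraMap_smul S x (q w), (hker x).2 ⟨1, mul_one x⟩, zero_smul]
  obtain ⟨a, b, ha, hab, hb⟩ := exists_exact_of_syzygy hS hM hf hp hpx hxF hgp hq hqx
  have hif : Function.Injective (LinearMap.ker f).subtype := Subtype.val_injective
  have hig : Function.Injective (LinearMap.ker g).subtype := Subtype.val_injective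
  have hexf : Function.Exact (LinearMap.ker f).subtype f := LinearMap.exact_subtype_ker_map f
  have hexg : Function.Exact (LinearMap.ker g).subtype g := LinearMap.exact_subtype_ker_map g
  have hiff (L : Type u) [AddCommGroup L] [Module R L] [Module S L] [IsScalarTower R S L] (i : ℕ) :
      ExtVanishes R (LinearMap.ker f) L (i + 1) ↔ ExtVanishes S Q L (i + 1) :=
    extVanishes_iff_of_regular hS hker hx i hq hqx hxN
  have hQ (L : Type u) [AddCommGroup L] [Module S L] (i : ℕ) (h₁ : ExtVanishes S M L (i + 1))
      (h₂ : ExtVanishes S M L (i + 2)) : ExtVanishes S Q L (i + 1) :=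
    ExtVanishes.contravariant_middle ha hab hb h₁
      ((ExtVanishes.add_two_iff (A := LinearMap.ker g) hig hexg hg i).1 h₂)
  have hNR (i : ℕ) : ExtVanishes R (LinearMap.ker f) R (i + 1) := by
    -- Shift up to `M`, which `x` kills, to replace the coefficients `R` by `S`; then shift back to
    -- `N`.
    refine (ExtVanishes.add_two_iff (A := LinearMap.ker f) hif hexf hf i).1 ?_
    refine ExtVanishes.of_quotient_of_smul_eq_zero (q := Algebra.linearMap R S) x hM
      ((injective_iff_map_eq_zero _).2 hx) hker hS ?_
    refine (ExtVanishes.add_two_iff (A := LinearMap.ker f) hif hexf hf i).2 ((hiff S i).2 ?_)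
    exact hQ S i (hMS _ i.succ_pos) (hMS _ (i + 1).succ_pos)
  have hNN : ∀ i, 0 < i → ExtVanishes R (LinearMap.ker f) (LinearMap.ker f) i := by
    refine hN (fun i hi ↦ ?_) ⟨d + 1, fun i hi ↦ ?_⟩
    · obtain ⟨j, rfl⟩ := Nat.exists_eq_add_one.2 hi
      exact hNR j
    -- The connecting map from `Ext(N, M)` to `Ext(N, N)` raises the degree by one, whence the bound
    -- `d + 1`.
    · obtain ⟨j, rfl⟩ : ∃ j, i = j + 2 := ⟨i - 2, by omega⟩
      refine ExtVanishes.covariant_left hif hexf hf ?_ (hNR _).pi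
      exact (hiff M j).2 (hQ M j (hd _ (by omega)) (hd _ (by omega)))
  have hQM (i : ℕ) : ExtVanishes S Q M (i + 1) :=
    (hiff M i).1 (ExtVanishes.covariant_right hif hexf hf (hNR i).pi (hNN _ (i + 1).succ_pos))
  have hstep (i : ℕ) (h : ExtVanishes S M M (i + 3)) : ExtVanishes S M M (i + 1) :=
    ExtVanishes.contravariant_left ha hab hb (hQM i)
      ((ExtVanishes.add_two_iff (A := LinearMap.ker g) hig hexg hg (i + 1)).1 h)
  have hdesc (j : ℕ) : ∀ i, d < i + 1 + 2 * j → ExtVanishes S M M (i + 1) := by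
    induction j with
    | zero => exact fun i hi ↦ hd _ hi
    | succ j ih => exact fun i hi ↦ hstep i (ih (i + 2) (by omega))
  intro i hi
  obtain ⟨j, rfl⟩ := Nat.exists_eq_add_one.2 hi
  -- `d` descents by two suffice, as `d < j + 1 + 2 * d`.
  exact hdesc d j (by omega)

theorem theorem2p3 (R : Type u) [CommRing R] [IsNoetherianRing R] [IsLocalRing R]
    (x : R) (hxm : x ∈ IsLocalRing.maximalIdeal R) (hx : x ∈ nonZeroDivisors R)
    (hR : SACC R) : SAC (R ⧸ Ideal.span {x}) := by
  intro M _ _ _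
  let : Module R M := Module.compHom M (Ideal.Quotient.mk (Ideal.span {x}))
  have : IsScalarTower R (R ⧸ Ideal.span {x}) M := .of_algebraMap_smul fun _ _ ↦ rfl
  have : Module.Finite R M := .trans (R ⧸ Ideal.span {x}) M
  obtain ⟨n, f, hf⟩ := Module.Finite.exists_fin' R M
  have hker (r : R) : algebraMap R (R ⧸ Ideal.span {x}) r = 0 ↔ ∃ s, x • s = r := by
    rw [Ideal.Quotient.algebraMap_eq, Ideal.Quotient.eq_zero_iff_mem, Ideal.mem_span_singleton']
    simp only [smul_eq_mul, mul_comm]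
  refine SymmetricAuslanderFor.of_ker Ideal.Quotient.mk_surjective hker
    (fun r hr ↦ (mem_nonZeroDivisors_iff.1 hx).1 r hr) hf (hR _ (hasConstantRank_ker hx ?_ f))
  intro m
  rw [← algebraMap_smul (R ⧸ Ideal.span {x}) x m, (hker x).2 ⟨1, mul_one x⟩, zero_smul]
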